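/- Let $(\mathcal S,\mathcal A,r,\mathbb P,\mu,T)$ be a finite-horizon Markov decision process: measurable state and action spaces $\mathcal S,\mathcal A$, a measurable reward $r:\mathcal S\times\mathcal A\to\mathbb R$, transition probabilities $\mathbb P(\cdot\mid s,a)$, an initial distribution $\mu$ on $\mathcal S$, and a horizon $T\in\mathbb N$. Let $\mathcal S_{\rm safe}\subseteq\mathcal S$ be measurable and let $\delta\in\mathbb R$ be the safety level. Let $(\pi_\theta)_{\theta\in\mathbb R^d}$ be a parametrized family of policies, that is, of stochastic kernels $\pi_\theta(a\mid s)$ from $\mathcal S$ to $\mathcal A$. Under $\pi_\theta$, we have $S_0\sim\mu$, $A_t\sim\pi_\theta(\cdot\mid S_t)$ and $S_{t+1}\sim\mathbb P(\cdot\mid S_t,A_t)$. Assume that $\sum_{t=0}^T r(S_t,A_t)$ is integrable under every $\pi_\theta$, and put $$V(\theta)=\mathbb E\Big[\sum_{t=0}^T r(S_t,A_t)\,\Big|\,\pi_\theta\Big],\qquad V_c(\theta)=\mathbb E\Big[\tfrac1{T+1}\sum_{t=0}^T \mathbf 1(S_t\in\mathcal S_{\rm safe})\,\Big|\,\pi_\theta\Big].$$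 Let $$P^\star=\sup\Big\{V(\theta):\ \mathbb P\Big(\bigcap_{t=0}^T\{S_t\in\mathcal S_{\rm safe}\}\,\Big|\,\pi_\theta\Big)\ge 1-\delta\Big\}$$ be the optimal value of the probabilistic-constrained problem, and let $$\hat P^\star=\sup\Big\{V(\theta):\ V_c(\theta)\ge 1-\tfrac{\delta}{T+1}\Big\}$$ be the optimal value of the cumulative-constrained problem (suprema in $[-\infty,\infty]$). Let $$\hat d(\lambda)=\max_{\theta\in\mathbb R^d}\ V(\theta)+\lambda\Big(V_c(\theta)-\big(1-\tfrac{\delta}{T+1}\big)\Big),\qquad \lambda\ge 0,$$ be the dual function of the latter, where for every $\lambda\ge0$ the maximum is assumed to be attained. Assume that the parametrization is universal: for every stochastic kernel $\pi$ from $\mathcal S$ to $\mathcal A$ there is $\theta\in\mathbb R^d$ with $\pi_\theta=\pi$. Let $\hat\lambda^\star\ge 0$ be an optimal dual multiplier, i.e. a minimizer of $\hat d$ over $[0,\infty)$. Then $$\hat P^\star\ \le\ P^\star\ \le\ \hat P^\star+\hat\lambda^\star\,\delta\,\frac{T}{T+1}.$$ -/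

import Mathlib

open MeasureTheory ProbabilityTheory

noncomputable section

namespace SafeRL

/-- A finite-horizon Markov decision process on measurable state and action spaces `S` and `A`. -/
structure MDP (S A : Type*) [MeasurableSpace S] [MeasurableSpace A] where
  /-- the reward function `r : S × A → ℝ` -/
  reward : S × A → ℝ
  measurable_reward : Measurable reward
  /-- the transition probabilities, `transition (s, a)` being the law of the next state -/
  transition : Kernel (S × A) S
  isMarkovKernel_transition : IsMarkovKernel transition
  /-- the initial state distribution -/
  init : Measure S
  isProbabilityMeasure_init : IsProbabilityMeasure init
  /-- the time horizon: the time steps are `0, 1, …, horizon` -/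
  horizon : ℕ

attribute [instance] MDP.isMarkovKernel_transition MDP.isProbabilityMeasure_init

variable {S A : Type*} [MeasurableSpace S] [MeasurableSpace A]

namespace MDP

/-- The law of `(S_{n+1}, A_{n+1})` given the past `(S_0, A_0), …, (S_n, A_n)`, under the policy
`π`: the next state is drawn from the transition kernel at `(S_n, A_n)`, and the next action is
then drawn from `π(· | S_{n+1})`. -/
def step (M : MDP S A) (π : Kernel S A) (n : ℕ) :
    Kernel ((_i : Finset.Iic n) → S × A) (S × A) :=
  (M.transition ⊗ₖ Kernel.prodMkLeft (S × A) π).comap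
    (fun h => h ⟨n, Finset.mem_Iic.2 le_rfl⟩) (measurable_pi_apply _)

instance (M : MDP S A) (π : Kernel S A) [IsMarkovKernel π] (n : ℕ) :
    IsMarkovKernel (M.step π n) := by
  unfold step; infer_instance

/-- The law of the state-action trajectory `(S_0, A_0), (S_1, A_1), …` under the policy `π`,
where `S_0` is drawn from the initial distribution and `A_0` from `π(· | S_0)`.
(Only the coordinates `0, …, horizon` are used below.) -/
def law (M : MDP S A) (π : Kernel S A) [IsMarkovKernel π] : Measure (ℕ → S × A) :=
  Kernel.trajMeasure (X := fun _ => S × A) (M.init ⊗ₘ π) (M.step π)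

/-- The total reward `∑_{t=0}^{T} r(S_t, A_t)` of a trajectory. -/
def totalReward (M : MDP S A) (ω : ℕ → S × A) : ℝ :=
  ∑ t ∈ Finset.range (M.horizon + 1), M.reward (ω t)

/-- The value function: the expected total reward of the policy `π`. -/
def value (M : MDP S A) (π : Kernel S A) [IsMarkovKernel π] : ℝ :=
  ∫ ω, M.totalReward ω ∂(M.law π)

/-- The probability that the state stays in `safe` at all times `0, …, T`. -/
def safeProb (M : MDP S A) (safe : Set S) (π : Kernel S A) [IsMarkovKernel π] : ℝ :=
  (M.law π).real (⋂ t ∈ Finset.range (M.horizon + 1), {ω | (ω t).1 ∈ safe})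

/-- The cumulative safety `𝔼[(1/(T+1)) ∑_{t=0}^{T} 𝟙(S_t ∈ safe)]`. -/
def cumSafety (M : MDP S A) (safe : Set S) (π : Kernel S A) [IsMarkovKernel π] : ℝ :=
  ∫ ω, (1 / ((M.horizon : ℝ) + 1)) *
    ∑ t ∈ Finset.range (M.horizon + 1), safe.indicator (fun _ => (1 : ℝ)) (ω t).1 ∂(M.law π)

end MDP

variable {Θ : Type*}

/-- The parametrization `θ ↦ π_θ` reaches every policy, i.e. every stochastic kernel from the
state space to the action space. -/
def IsUniversal (π : Θ → Kernel S A) : Prop :=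
  ∀ κ : Kernel S A, IsMarkovKernel κ → ∃ θ, π θ = κ

/-- The policy `π` is `(1 - δ)`-safe for the set `safe`. -/
def IsSafe (M : MDP S A) (safe : Set S) (δ : ℝ) (π : Kernel S A) [IsMarkovKernel π] : Prop :=
  1 - δ ≤ M.safeProb safe π

/-- Optimal value of the probabilistic-constrained problem: maximize the value over the
parameters whose policy is `(1 - δ)`-safe. -/
def probOpt (M : MDP S A) (safe : Set S) (δ : ℝ) (π : Θ → Kernel S A)
    [∀ θ, IsMarkovKernel (π θ)] : EReal :=
  ⨆ θ ∈ {θ | IsSafe M safe δ (π θ)}, (M.value (π θ) : EReal)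

/-- The threshold `1 - δ / (T + 1)` of the cumulative-constrained problem. -/
def threshold (M : MDP S A) (δ : ℝ) : ℝ := 1 - δ / ((M.horizon : ℝ) + 1)

/-- Optimal value of the cumulative-constrained problem: maximize the value over the
parameters whose cumulative safety is at least `1 - δ / (T + 1)`. -/
def cumOpt (M : MDP S A) (safe : Set S) (δ : ℝ) (π : Θ → Kernel S A)
    [∀ θ, IsMarkovKernel (π θ)] : EReal :=
  ⨆ θ ∈ {θ | threshold M δ ≤ M.cumSafety safe (π θ)}, (M.value (π θ) : EReal)

/-- The Lagrangian of the cumulative-constrained problem. -/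
def cumLagrangian (M : MDP S A) (safe : Set S) (δ : ℝ) (π : Θ → Kernel S A)
    [∀ θ, IsMarkovKernel (π θ)] (lam : ℝ) (θ : Θ) : ℝ :=
  M.value (π θ) + lam * (M.cumSafety safe (π θ) - threshold M δ)

/-- The dual function of the cumulative-constrained problem. -/
def cumDual (M : MDP S A) (safe : Set S) (δ : ℝ) (π : Θ → Kernel S A)
    [∀ θ, IsMarkovKernel (π θ)] (lam : ℝ) : EReal :=
  ⨆ θ, (cumLagrangian M safe δ π lam θ : EReal)

/-- `lam` is an optimal dual multiplier of the cumulative-constrained problem: it minimizes the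
dual function over `[0, ∞)`. -/
def IsOptimalMultiplier (M : MDP S A) (safe : Set S) (δ : ℝ) (π : Θ → Kernel S A)
    [∀ θ, IsMarkovKernel (π θ)] (lam : ℝ) : Prop :=
  lam ∈ Set.Ici (0 : ℝ) ∧ IsMinOn (cumDual M safe δ π) (Set.Ici 0) lam

end SafeRL

end

namespace SafeRL

open Filter Topology

/-! Write `V`, `V_c` for value and cumulative safety, `L` for the Lagrangian. The left inequality is
inclusion of feasible sets, by the union bound `one_sub_safeProb_le`. For the right one, take `lam >
lamHat` and a maximizer `θ₀` of `L lam`. Minimality of the dual function at `lamHat` forces `θ₀` to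
be feasible (`threshold_le_cumSafety_of_lt`), so `V θ₀ ≤ cumOpt`. For a safe `θ`, `L lam θ ≤ L lam
θ₀` gives `V θ ≤ V θ₀ + lam * (V_c θ₀ - V_c θ)`. The time-0 terms of `V_c` cancel, as the law of
`S_0` ignores the policy; each of the other `T` terms contributes at most `δ / (T + 1)`
(`cumSafety_sub_cumSafety_le`). Then `lam` decreases to `lamHat`. -/

/-- The initial coordinate of a trajectory is distributed according to the initial measure. -/
lemma map_eval_zero_trajMeasure {X : ℕ → Type*} [∀ n, MeasurableSpace (X n)]
    (μ₀ : Measure (X 0)) (κ : (n : ℕ) → Kernel ((i : Finset.Iic n) → X i) (X (n + 1)))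
    [∀ n, IsMarkovKernel (κ n)] :
    (Kernel.trajMeasure μ₀ κ).map (fun x => x 0) = μ₀ := by
  let eval : ((i : Finset.Iic 0) → X i) → X 0 := fun y => y ⟨0, Finset.mem_Iic.2 le_rfl⟩
  have heval : Measurable eval := measurable_pi_apply _
  have hpast : (Kernel.trajMeasure μ₀ κ).map (Preorder.frestrictLe 0) =
      μ₀.map (MeasurableEquiv.piUnique (fun i : Finset.Iic 0 => X i)).symm := by
    rw [Kernel.trajMeasure, Measure.map_comp _ _ (by fun_prop), Kernel.traj_map_frestrictLe,
      Kernel.partialTraj_self, Measure.id_comp]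
    rfl
  calc (Kernel.trajMeasure μ₀ κ).map (fun x => x 0)
      = ((Kernel.trajMeasure μ₀ κ).map (Preorder.frestrictLe 0)).map eval :=
        (Measure.map_map heval (Preorder.measurable_frestrictLe 0)).symm
    _ = (μ₀.map (MeasurableEquiv.piUnique (fun i : Finset.Iic 0 => X i)).symm).map eval := by
        rw [hpast]
    _ = μ₀.map id := Measure.map_map heval (MeasurableEquiv.measurable _)
    _ = μ₀ := Measure.map_id

namespace MDP

variable {S A : Type*} [MeasurableSpace S] [MeasurableSpace A]

instance isProbabilityMeasure_law (M : MDP S A) (π : Kernel S A) [IsMarkovKernel π] :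
    IsProbabilityMeasure (M.law π) := by
  unfold law; infer_instance

/-- The trajectories whose state at time `t` is safe. -/
def safeAt (A : Type*) (safe : Set S) (t : ℕ) : Set (ℕ → S × A) := {ω | (ω t).1 ∈ safe}

lemma measurableSet_safeAt {safe : Set S} (hsafe : MeasurableSet safe) (t : ℕ) :
    MeasurableSet (safeAt A safe t) :=
  (measurable_fst.comp (measurable_pi_apply t)) hsafe

/-- The probability that the initial state is safe does not depend on the policy. -/
lemma law_real_safeAt_zero (M : MDP S A) {safe : Set S} (hsafe : MeasurableSet safe)
    (π : Kernel S A) [IsMarkovKernel π] :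
    (M.law π).real (safeAt A safe 0) = M.init.real safe := by
  have h0 : (M.law π).map (fun ω => ω 0) = M.init ⊗ₘ π :=
    map_eval_zero_trajMeasure (X := fun _ => S × A) _ _
  have h1 : ((M.law π).map (fun ω => ω 0)).fst = M.init := by rw [h0, Measure.fst_compProd]
  rw [← h1, Measure.fst, Measure.map_map measurable_fst (measurable_pi_apply 0),
    map_measureReal_apply (measurable_fst.comp (measurable_pi_apply 0)) hsafe]
  rfl

lemma cumSafety_eq_sum (M : MDP S A) {safe : Set S} (hsafe : MeasurableSet safe)
    (π : Kernel S A) [IsMarkovKernel π] :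
    M.cumSafety safe π = (1 / ((M.horizon : ℝ) + 1)) *
      ∑ t ∈ Finset.range (M.horizon + 1), (M.law π).real (safeAt A safe t) := by
  have hind (t : ℕ) : (fun ω : ℕ → S × A => safe.indicator (fun _ => (1 : ℝ)) (ω t).1) =
      (safeAt A safe t).indicator 1 := rfl
  rw [cumSafety, integral_const_mul, integral_finsetSum]
  · simp_rw [hind, integral_indicator_one (measurableSet_safeAt hsafe _)]
  · intro t _
    rw [hind]
    exact (integrable_const (1 : ℝ)).indicator (measurableSet_safeAt hsafe t)

/-- Union bound: the total expected number of unsafe times bounds the probability of leaving the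
safe set. -/
lemma one_sub_safeProb_le (M : MDP S A) {safe : Set S} (hsafe : MeasurableSet safe)
    (π : Kernel S A) [IsMarkovKernel π] :
    1 - M.safeProb safe π ≤ ((M.horizon : ℝ) + 1) * (1 - M.cumSafety safe π) := by
  have hm : MeasurableSet (⋂ t ∈ Finset.range (M.horizon + 1), safeAt A safe t) :=
    Finset.measurableSet_biInter _ fun t _ => measurableSet_safeAt hsafe t
  have hunion := measureReal_biUnion_finset_le (μ := M.law π) (Finset.range (M.horizon + 1))
    fun t => (safeAt A safe t)ᶜ
  simp_rw [← Set.compl_iInter, probReal_compl_eq_one_sub hm,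
    probReal_compl_eq_one_sub (measurableSet_safeAt hsafe _)] at hunion
  rw [cumSafety_eq_sum M hsafe]
  -- The left side is `1 - safeProb` by definition: no safe event fails exactly on their
  -- intersection.
  refine hunion.trans_eq ?_
  have hT : (M.horizon : ℝ) + 1 ≠ 0 := by positivity
  simp only [Finset.sum_sub_distrib, Finset.sum_const, Finset.card_range, nsmul_eq_mul,
    Nat.cast_add, Nat.cast_one]
  field_simp

lemma safeProb_le_real_safeAt (M : MDP S A) (safe : Set S) (π : Kernel S A) [IsMarkovKernel π]
    {t : ℕ} (ht : t ∈ Finset.range (M.horizon + 1)) :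
    M.safeProb safe π ≤ (M.law π).real (safeAt A safe t) :=
  measureReal_mono (Set.biInter_subset_of_mem ht)

/-- Only times `t ≥ 1` are bounded by 1. Time 0 is kept exact so that it cancels against
`le_cumSafety`; this yields the factor `T / (T + 1)` instead of 1. -/
lemma cumSafety_le (M : MDP S A) {safe : Set S} (hsafe : MeasurableSet safe)
    (π : Kernel S A) [IsMarkovKernel π] :
    M.cumSafety safe π ≤ (1 / ((M.horizon : ℝ) + 1)) * (M.horizon + M.init.real safe) := by
  rw [cumSafety_eq_sum M hsafe, Finset.sum_range_succ', law_real_safeAt_zero M hsafe]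
  gcongr
  refine (Finset.sum_le_sum fun t _ => measureReal_le_one).trans ?_
  simp

/-- Staying safe throughout implies being safe at each single time; this is used for `t ≥ 1` only.
-/
lemma le_cumSafety (M : MDP S A) {safe : Set S} (hsafe : MeasurableSet safe)
    (π : Kernel S A) [IsMarkovKernel π] :
    (1 / ((M.horizon : ℝ) + 1)) * (M.horizon * M.safeProb safe π + M.init.real safe) ≤
      M.cumSafety safe π := by
  rw [cumSafety_eq_sum M hsafe, Finset.sum_range_succ', law_real_safeAt_zero M hsafe]
  gcongr
  calc (M.horizon : ℝ) * M.safeProb safe π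
      = ∑ _t ∈ Finset.range M.horizon, M.safeProb safe π := by simp
    _ ≤ _ := Finset.sum_le_sum fun t ht => safeProb_le_real_safeAt M safe π (by
        simpa using ht)

/-- Any two policies have initial states with the same law, so that the cumulative safety of a
`(1 - δ)`-safe policy is smaller than that of another policy by at most `δ T / (T + 1)`. -/
lemma cumSafety_sub_cumSafety_le (M : MDP S A) {safe : Set S} (hsafe : MeasurableSet safe) {δ : ℝ}
    (π π' : Kernel S A) [IsMarkovKernel π] [IsMarkovKernel π'] (hπ : IsSafe M safe δ π) :
    M.cumSafety safe π' - M.cumSafety safe π ≤ δ * ((M.horizon : ℝ) / ((M.horizon : ℝ) + 1)) := by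
  have hsafe' : 1 - M.safeProb safe π ≤ δ := by linarith [show 1 - δ ≤ M.safeProb safe π from hπ]
  calc M.cumSafety safe π' - M.cumSafety safe π
      ≤ (1 / ((M.horizon : ℝ) + 1)) * (M.horizon + M.init.real safe) -
        (1 / ((M.horizon : ℝ) + 1)) * (M.horizon * M.safeProb safe π + M.init.real safe) :=
        sub_le_sub (cumSafety_le M hsafe π') (le_cumSafety M hsafe π)
    _ = (1 - M.safeProb safe π) * ((M.horizon : ℝ) / ((M.horizon : ℝ) + 1)) := by ring
    _ ≤ _ := by gcongr

end MDP

variable {S A Θ : Type*} [MeasurableSpace S] [MeasurableSpace A]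

lemma isSafe_of_threshold_le_cumSafety (M : MDP S A) {safe : Set S} (hsafe : MeasurableSet safe)
    {δ : ℝ} (π : Kernel S A) [IsMarkovKernel π] (h : threshold M δ ≤ M.cumSafety safe π) :
    IsSafe M safe δ π := by
  have hT : (0 : ℝ) < (M.horizon : ℝ) + 1 := by positivity
  have h1 : ((M.horizon : ℝ) + 1) * (1 - M.cumSafety safe π) ≤ δ := by
    rw [mul_comm, ← le_div_iff₀ hT]
    unfold threshold at h
    linarith
  have h2 := M.one_sub_safeProb_le hsafe π
  unfold IsSafe
  linarith

/-- A maximizer of the Lagrangian at a multiplier larger than an optimal one is feasible. -/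
lemma threshold_le_cumSafety_of_lt (M : MDP S A) (safe : Set S) (δ : ℝ) (π : Θ → Kernel S A)
    [∀ θ, IsMarkovKernel (π θ)] {lamHat lam : ℝ} (hlam : IsOptimalMultiplier M safe δ π lamHat)
    (hlt : lamHat < lam) {θ₀ : Θ}
    (hθ₀ : ∀ θ, cumLagrangian M safe δ π lam θ ≤ cumLagrangian M safe δ π lam θ₀) :
    threshold M δ ≤ M.cumSafety safe (π θ₀) := by
  have hdual : cumDual M safe δ π lamHat ≤ cumDual M safe δ π lam :=
    hlam.2 (Set.mem_Ici.2 ((Set.mem_Ici.1 hlam.1).trans hlt.le))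
  -- The dual values at `lamHat` and `lam` lie between these two, and their difference is `lam -
  -- lamHat` times the constraint slack at `θ₀`.
  have hle : (cumLagrangian M safe δ π lamHat θ₀ : EReal) ≤ cumLagrangian M safe δ π lam θ₀ :=
    (le_iSup (fun θ => (cumLagrangian M safe δ π lamHat θ : EReal)) θ₀).trans
      (hdual.trans (iSup_le fun θ => EReal.coe_le_coe_iff.2 (hθ₀ θ)))
  have hle' := EReal.coe_le_coe_iff.1 hle
  unfold cumLagrangian at hle'
  have hnonneg : 0 ≤ (lam - lamHat) * (M.cumSafety safe (π θ₀) - threshold M δ) := by linarith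
  exact sub_nonneg.1 (nonneg_of_mul_nonneg_right hnonneg (sub_pos.2 hlt))

lemma cumOpt_le_probOpt (M : MDP S A) {safe : Set S} (hsafe : MeasurableSet safe) (δ : ℝ)
    (π : Θ → Kernel S A) [∀ θ, IsMarkovKernel (π θ)] :
    cumOpt M safe δ π ≤ probOpt M safe δ π :=
  biSup_mono fun θ hθ => isSafe_of_threshold_le_cumSafety M hsafe (π θ) hθ

/-- Above the optimal multiplier, the Lagrangian maximizers are feasible, which bounds the value of
a safe policy without any appeal to strong duality. -/
lemma value_sub_le_cumOpt (M : MDP S A) {safe : Set S} (hsafe : MeasurableSet safe) {δ : ℝ}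
    (π : Θ → Kernel S A) [∀ θ, IsMarkovKernel (π θ)]
    (hmax : ∀ lam : ℝ, 0 ≤ lam →
      ∃ θ₀, ∀ θ, cumLagrangian M safe δ π lam θ ≤ cumLagrangian M safe δ π lam θ₀)
    {lamHat lam : ℝ} (hlam : IsOptimalMultiplier M safe δ π lamHat) (hlt : lamHat < lam)
    {θ : Θ} (hθ : IsSafe M safe δ (π θ)) :
    ((M.value (π θ) - lam * δ * ((M.horizon : ℝ) / ((M.horizon : ℝ) + 1)) : ℝ) : EReal) ≤
      cumOpt M safe δ π := by
  have hlam0 : 0 ≤ lam := (Set.mem_Ici.1 hlam.1).trans hlt.le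
  obtain ⟨θ₀, hθ₀⟩ := hmax lam hlam0
  have hfeas := threshold_le_cumSafety_of_lt M safe δ π hlam hlt hθ₀
  have hL := hθ₀ θ
  unfold cumLagrangian at hL
  have hgap := mul_le_mul_of_nonneg_left
    (M.cumSafety_sub_cumSafety_le hsafe (π θ) (π θ₀) hθ) hlam0
  refine le_trans (EReal.coe_le_coe_iff.2 (?_ : _ ≤ M.value (π θ₀)))
    (le_biSup (fun θ => (M.value (π θ) : EReal)) hfeas)
  linarith

/-- A Lagrangian maximizer at `lamHat` itself need not be feasible, so the bound is obtained as a
limit from the right. -/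
lemma probOpt_le_cumOpt_add (M : MDP S A) {safe : Set S} (hsafe : MeasurableSet safe) {δ : ℝ}
    (π : Θ → Kernel S A) [∀ θ, IsMarkovKernel (π θ)]
    (hmax : ∀ lam : ℝ, 0 ≤ lam →
      ∃ θ₀, ∀ θ, cumLagrangian M safe δ π lam θ ≤ cumLagrangian M safe δ π lam θ₀)
    {lamHat : ℝ} (hlam : IsOptimalMultiplier M safe δ π lamHat) :
    probOpt M safe δ π ≤ cumOpt M safe δ π +
      ((lamHat * δ * ((M.horizon : ℝ) / ((M.horizon : ℝ) + 1)) : ℝ) : EReal) := by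
  refine iSup₂_le fun θ hθ => ?_
  set b : ℝ := (M.horizon : ℝ) / ((M.horizon : ℝ) + 1) with hb
  have hcont : Continuous fun lam : ℝ => ((M.value (π θ) - lam * δ * b : ℝ) : EReal) :=
    continuous_coe_real_ereal.comp (by fun_prop)
  have hlim : ((M.value (π θ) - lamHat * δ * b : ℝ) : EReal) ≤ cumOpt M safe δ π :=
    le_of_tendsto ((hcont.tendsto lamHat).mono_left (nhdsWithin_le_nhds (s := Set.Ioi lamHat)))
      (eventually_mem_nhdsWithin.mono fun lam hlt =>
        value_sub_le_cumOpt M hsafe π hmax hlam hlt hθ)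
  calc (M.value (π θ) : EReal)
      = ((M.value (π θ) - lamHat * δ * b : ℝ) : EReal) + ((lamHat * δ * b : ℝ) : EReal) := by
        rw [← EReal.coe_add, sub_add_cancel]
    _ ≤ _ := by gcongr

end SafeRL

theorem theorem1 {S A : Type*} [MeasurableSpace S] [MeasurableSpace A]
    (M : SafeRL.MDP S A) (safe : Set S) (hsafe : MeasurableSet safe) (δ : ℝ) (d : ℕ)
    (π : EuclideanSpace ℝ (Fin d) → ProbabilityTheory.Kernel S A)
    [∀ θ, ProbabilityTheory.IsMarkovKernel (π θ)]
    -- universal parametrization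
    (huniv : SafeRL.IsUniversal π)
    -- the value function is well defined
    (hint : ∀ θ, MeasureTheory.Integrable M.totalReward (M.law (π θ)))
    -- the dual function is a maximum
    (hmax : ∀ lam : ℝ, 0 ≤ lam →
      ∃ θ₀, ∀ θ, SafeRL.cumLagrangian M safe δ π lam θ ≤ SafeRL.cumLagrangian M safe δ π lam θ₀)
    (lamHat : ℝ) (hlam : SafeRL.IsOptimalMultiplier M safe δ π lamHat) :
    SafeRL.cumOpt M safe δ π ≤ SafeRL.probOpt M safe δ π ∧
      SafeRL.probOpt M safe δ π ≤ SafeRL.cumOpt M safe δ π +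
        ((lamHat * δ * ((M.horizon : ℝ) / ((M.horizon : ℝ) + 1)) : ℝ) : EReal) :=
  ⟨SafeRL.cumOpt_le_probOpt M hsafe δ π, SafeRL.probOpt_le_cumOpt_add M hsafe π hmax hlam⟩
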